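/- **Setting.** A (turn-based, finite) stochastic game $G$ has finitely many states, partitioned into the states $S_\Box$ of Maximizer and $S_\circ$ of Minimizer, finitely many actions, a nonempty set $A(s)$ of available actions in each state $s$, and a distribution $\delta(s,a)$ over successor states for each $a\in A(s)$, with support $\mathrm{post}(s,a)$. For $f:S\to\mathbb R$ put $f(s,a)=\sum_{s'}\delta(s,a,s')f(s')$. Strategies are memoryless and deterministic: $\sigma(s)\in A(s)$ for $s\in S_\Box$ (Maximizer), $\tau(s)\in A(s)$ for $s\in S_\circ$ (Minimizer). An objective $\Phi$ is a measurable payoff in $\mathbb R\cup\{\infty\}$ on infinite paths with well-defined expectations, and $V_{G,\Phi}(s)=\sup_\sigma\inf_\tau\mathbb E^{\sigma,\tau}_{G,s}[\Phi]$. Canonical form of $G$ for $\Phi$ means that all values are finite and that the states which $\Phi$ designates as absorbing (e.g. target states for reachability) have a single action, leading back to themselves. $\Phi$ is *fixpoint-linear* if there are offsets $\mathrm{off}_\Phi(s)\ge 0$ such that for every game in canonical form its value $V$ satisfies $V(s)=\mathrm{opt}_{a\in A(s)}\bigl(\mathrm{off}_\Phi(s)+V(s,a)\bigr)$, with $\mathrm{opt}=\max$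 for $s\in S_\Box$ and $\min$ for $s\in S_\circ$. $G^{\cdot,\tau}$ and $G^{\sigma,\cdot}$ denote the Markov decision processes obtained from $G$ by fixing $\tau$ or $\sigma$. An *end component* $E=(R,B)$ consists of a nonempty set $R$ of states and a nonempty set of available actions $B(s)\subseteq A(s)$, $s\in R$, such that $\mathrm{post}(s,a)\subseteq R$ for $s\in R$, $a\in B(s)$, and any two states of $R$ are connected by a path inside $R$ using only actions of $B$. It is *simple* if $V_{G,\Phi}(s)=V_{G,\Phi}(s,a)$ for all $s\in R$, $a\in B(s)$. A pair $(s,a)$ with $s\in R$, $a\in A(s)$ *exits* $E$ if $\mathrm{post}(s,a)\not\subseteq R$. The best exit values are $$\mathrm{exit}^\Box_f(E)=\max_{s\in R\cap S_\Box,\ (s,a)\text{ exits }E} f(s,a),\qquad \mathrm{exit}^\circ_f(E)=\min_{s\in R\cap S_\circ,\ (s,a)\text{ exits }E} f(s,a),$$ with $\max\emptyset=-\infty$, $\min\emptyset=\infty$. The *staying value* $\mathrm{stay}_{H,\Phi}(E,s)$ in a game $H$ is the value of $s$ in $H$ restricted to the states and actions of $E$. **Statement.** Let $\Phi$ be a fixpoint-linear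 objective and $G$ a stochastic game in canonical form for $\Phi$ in which both players have optimal memoryless deterministic strategies (each guaranteeing the value from every state). Let $E=(R,B)$ be a simple end component of $G$ that contains every action staying in it, i.e. $a\in B(s)$ whenever $s\in R$, $a\in A(s)$ and $(s,a)$ does not exit $E$. 1. Let $\tau$ be a memoryless deterministic Minimizer strategy with $\tau(s)\in B(s)$ for all $s\in R\cap S_\circ$, and let $f:S\to\mathbb R$ satisfy $f\ge V_{G,\Phi}$. Then for every $s\in R$, $$V_{G,\Phi}(s)\le\max\bigl(\mathrm{stay}_{G^{\cdot,\tau},\Phi}(E,s),\ \mathrm{exit}^\Box_f(E)\bigr).$$ 2. Dually, let $\sigma$ be a memoryless deterministic Maximizer strategy with $\sigma(s)\in B(s)$ for all $s\in R\cap S_\Box$, and let $f:S\to\mathbb R$ satisfy $f\le V_{G,\Phi}$. Then for every $s\in R$, $$V_{G,\Phi}(s)\ge\min\bigl(\mathrm{stay}_{G^{\sigma,\cdot},\Phi}(E,s),\ \mathrm{exit}^\circ_f(E)\bigr).$$ -/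

import Mathlib

open MeasureTheory ProbabilityTheory
open scoped ENNReal

noncomputable section

/-- The data of a turn-based stochastic game whose states and actions are elements of `S`, `A`.
Games with different state sets (a game and its restriction to a component, say) live over the
same `S` and `A`. -/
structure StochasticGame (S A : Type*) where
  /-- the states of Maximizer -/
  maxStates : Set S
  /-- the states of Minimizer -/
  minStates : Set S
  /-- the actions available in a state -/
  avail : S → Set A
  /-- the transition function; only its values at available actions matter -/
  trans : S → A → PMF S

/-- A set of states together with a choice of actions in each of them
(the values of `actions` outside `states` are irrelevant). -/
structure Component (S A : Type*) where
  states : Set S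
  actions : S → Set A

section Chain

variable {S A : Type*} [MeasurableSpace S] [DiscreteMeasurableSpace S]
  [MeasurableSpace A] [DiscreteMeasurableSpace A]

/-- The one-step Markov kernel of the Markov chain with transition function `P`. -/
def chainKernel (P : S → PMF S) : Kernel S S where
  toFun s := (P s).toMeasure
  measurable' := Measurable.of_discrete

instance (P : S → PMF S) : IsMarkovKernel (chainKernel P) :=
  ⟨fun s => PMF.toMeasure.isProbabilityMeasure (P s)⟩

/-- The kernel which, given the first `n + 1` states of a path, yields the law of the next one. -/
def stepKernel (P : S → PMF S) (n : ℕ) : Kernel (Π _ : Finset.Iic n, S) S :=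
  (chainKernel P).comap (fun h => h ⟨n, Finset.mem_Iic.2 le_rfl⟩) (measurable_pi_apply _)

instance (P : S → PMF S) (n : ℕ) : IsMarkovKernel (stepKernel P n) := by
  unfold stepKernel; infer_instance

/-- The probability measure on infinite state sequences `s₀ s₁ s₂ …` induced by the Markov chain
`P` started in `s`. -/
def chainMeasure (P : S → PMF S) (s : S) : Measure (ℕ → S) :=
  Kernel.traj (X := fun _ => S) (stepKernel P) 0 (fun _ => s)

/-- The law of the infinite path `(s₀, a₀) (s₁, a₁) …` of the Markov chain `P` started in `s`,
where in each state `t` the action `π t` is played. -/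
def pathLaw (P : S → PMF S) (π : S → A) (s : S) : Measure (ℕ → S × A) :=
  (chainMeasure P s).map (fun ρ i => (ρ i, π (ρ i)))

end Chain

/-- The expectation `E[X⁺] - E[X⁻]` of an extended real random variable
(used only where `E[X⁻]` is finite). -/
def extExpectation {Ω : Type*} [MeasurableSpace Ω] (μ : Measure Ω) (X : Ω → EReal) : EReal :=
  ((∫⁻ ω, (X ω).toENNReal ∂μ : ℝ≥0∞) : EReal) - ((∫⁻ ω, (-(X ω)).toENNReal ∂μ : ℝ≥0∞) : EReal)

/-- An objective: a measurable payoff in `ℝ ∪ {∞}` for every path, with a well-defined expectation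
in every Markov chain. The set `absorbing` records which states the canonical form of the objective
requires to be absorbing (the target states for reachability, the avoid states for safety, none for
total reward and mean payoff). -/
structure Objective (S A : Type*) [MeasurableSpace S] [DiscreteMeasurableSpace S]
    [MeasurableSpace A] [DiscreteMeasurableSpace A] where
  payoff : (ℕ → S × A) → EReal
  measurable_payoff : Measurable payoff
  payoff_ne_bot : ∀ w, payoff w ≠ ⊥
  lintegral_neg_ne_top : ∀ (P : S → PMF S) (π : S → A) (s : S),
    ∫⁻ w, (-(payoff w)).toENNReal ∂(pathLaw P π s) ≠ ⊤
  absorbing : Set S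

namespace StochasticGame

variable {S A : Type*}

/-- All states of the game. -/
def states (G : StochasticGame S A) : Set S := G.maxStates ∪ G.minStates

/-- The successors of `s` under `a`. -/
def post (G : StochasticGame S A) (s : S) (a : A) : Set S := (G.trans s a).support

/-- The data form a game: each state has exactly one owner and at least one available action, and
available actions do not leave the state set. -/
structure WellFormed (G : StochasticGame S A) : Prop where
  disjoint : Disjoint G.maxStates G.minStates
  avail_nonempty : ∀ s ∈ G.states, (G.avail s).Nonempty
  post_subset : ∀ s ∈ G.states, ∀ a ∈ G.avail s, G.post s a ⊆ G.states

/-- `f(s, a)`: the expected value of `f` after playing `a` once in `s`. -/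
def next [Fintype S] (G : StochasticGame S A) (f : S → ℝ) (s : S) (a : A) : ℝ :=
  ∑ t, (G.trans s a t).toReal * f t

/-- Memoryless deterministic strategies of Maximizer
(the values outside Maximizer's states are irrelevant). -/
def IsMaxStrategy (G : StochasticGame S A) (σ : S → A) : Prop := ∀ s ∈ G.maxStates, σ s ∈ G.avail s

/-- Memoryless deterministic strategies of Minimizer
(the values outside Minimizer's states are irrelevant). -/
def IsMinStrategy (G : StochasticGame S A) (τ : S → A) : Prop := ∀ s ∈ G.minStates, τ s ∈ G.avail s

open scoped Classical in
/-- The action played under the strategy profile `(σ, τ)`. -/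
def profile (G : StochasticGame S A) (σ τ : S → A) (s : S) : A :=
  if s ∈ G.maxStates then σ s else τ s

open scoped Classical in
/-- The Markov decision process (of Maximizer) obtained by fixing the Minimizer strategy `τ`. -/
def fixMin (G : StochasticGame S A) (τ : S → A) : StochasticGame S A where
  maxStates := G.states
  minStates := ∅
  avail s := if s ∈ G.minStates then {τ s} else G.avail s
  trans := G.trans

open scoped Classical in
/-- The Markov decision process (of Minimizer) obtained by fixing the Maximizer strategy `σ`. -/
def fixMax (G : StochasticGame S A) (σ : S → A) : StochasticGame S A where
  maxStates := ∅
  minStates := G.states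
  avail s := if s ∈ G.maxStates then {σ s} else G.avail s
  trans := G.trans

/-- The game restricted to the states and actions of `E`. -/
def restrict (G : StochasticGame S A) (E : Component S A) : StochasticGame S A where
  maxStates := G.maxStates ∩ E.states
  minStates := G.minStates ∩ E.states
  avail s := G.avail s ∩ E.actions s
  trans := G.trans

/-- `E` is an end component: a nonempty set of states with a nonempty set of available actions,
closed under these actions, and such that any state of `E` can be reached from any other one by
a finite path that stays in `E` and uses only actions of `E`. -/
structure IsEndComponent (G : StochasticGame S A) (E : Component S A) : Prop where
  nonempty : E.states.Nonempty
  states_subset : E.states ⊆ G.states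
  actions_subset : ∀ s ∈ E.states, E.actions s ⊆ G.avail s
  actions_nonempty : ∃ s ∈ E.states, (E.actions s).Nonempty
  closed : ∀ s ∈ E.states, ∀ a ∈ E.actions s, G.post s a ⊆ E.states
  connected : ∀ s ∈ E.states, ∀ t ∈ E.states,
    Relation.ReflTransGen (fun u v => u ∈ E.states ∧ ∃ a ∈ E.actions u, v ∈ G.post u a) s t

/-- The action `a` exits `E` in `s`. -/
def Exits (G : StochasticGame S A) (E : Component S A) (s : S) (a : A) : Prop :=
  s ∈ E.states ∧ a ∈ G.avail s ∧ ¬ G.post s a ⊆ E.states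

/-- `E` contains every available action that does not exit it, i.e. `E` is determined by its set
of states. -/
def ContainsStayingActions (G : StochasticGame S A) (E : Component S A) : Prop :=
  ∀ s ∈ E.states, ∀ a ∈ G.avail s, ¬ G.Exits E s a → a ∈ E.actions s

/-- `E` is a simple end component for the assignment `f`. -/
structure IsSimpleEndComponent [Fintype S] (G : StochasticGame S A) (f : S → ℝ)
    (E : Component S A) : Prop extends G.IsEndComponent E where
  eq_next : ∀ s ∈ E.states, ∀ a ∈ E.actions s, f s = G.next f s a

/-- The best exit value of Maximizer from `E` under `f` (`⊥ = -∞` if there is no exit). -/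
def exitMax [Fintype S] (G : StochasticGame S A) (f : S → ℝ) (E : Component S A) : EReal :=
  sSup {x | ∃ s ∈ G.maxStates, ∃ a, G.Exits E s a ∧ x = (G.next f s a : EReal)}

/-- The best exit value of Minimizer from `E` under `f` (`⊤ = ∞` if there is no exit). -/
def exitMin [Fintype S] (G : StochasticGame S A) (f : S → ℝ) (E : Component S A) : EReal :=
  sInf {x | ∃ s ∈ G.minStates, ∃ a, G.Exits E s a ∧ x = (G.next f s a : EReal)}

variable [MeasurableSpace S] [DiscreteMeasurableSpace S]
  [MeasurableSpace A] [DiscreteMeasurableSpace A]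

/-- The expected payoff from `s` when the players use `σ` and `τ`. -/
def expPayoff (G : StochasticGame S A) (Φ : Objective S A) (σ τ : S → A) (s : S) : EReal :=
  extExpectation
    (pathLaw (fun t => G.trans t (G.profile σ τ t)) (G.profile σ τ) s) Φ.payoff

/-- The value of the state `s`. -/
def value (G : StochasticGame S A) (Φ : Objective S A) (s : S) : EReal :=
  ⨆ σ : {σ : S → A // G.IsMaxStrategy σ}, ⨅ τ : {τ : S → A // G.IsMinStrategy τ},
    G.expPayoff Φ σ.1 τ.1 s

/-- The value as a real assignment; meaningful where the value is finite. -/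
def realValue (G : StochasticGame S A) (Φ : Objective S A) (s : S) : ℝ := (G.value Φ s).toReal

/-- The staying value of `s` in `E`. -/
def stay (G : StochasticGame S A) (Φ : Objective S A) (E : Component S A) (s : S) : EReal :=
  (G.restrict E).value Φ s

/-- Memoryless deterministic strategies suffice for both players: each has one that guarantees
the value from every state. In particular the supremum and the infimum in the definition of the
value can be exchanged. -/
def HasOptimalStrategies (G : StochasticGame S A) (Φ : Objective S A) : Prop :=
  (∃ σ, G.IsMaxStrategy σ ∧ ∀ s ∈ G.states, ∀ τ, G.IsMinStrategy τ →
    G.value Φ s ≤ G.expPayoff Φ σ τ s) ∧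
  (∃ τ, G.IsMinStrategy τ ∧ ∀ s ∈ G.states, ∀ σ, G.IsMaxStrategy σ →
    G.expPayoff Φ σ τ s ≤ G.value Φ s)

/-- The game is in canonical form for `Φ`: the states that have to be absorbing have a single
action, which leads back to them, and all values are finite. -/
structure IsCanonical (G : StochasticGame S A) (Φ : Objective S A) : Prop where
  absorbing : ∀ s ∈ G.states, s ∈ Φ.absorbing → ∃ a, G.avail s = {a} ∧ G.trans s a = PMF.pure s
  value_ne_top : ∀ s ∈ G.states, G.value Φ s ≠ ⊤
  value_ne_bot : ∀ s ∈ G.states, G.value Φ s ≠ ⊥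

end StochasticGame

/-- The objective is fixpoint-linear: for some offsets `off s ≥ 0`, the value `V` of every game in
canonical form solves `V s = opt_{a ∈ avail s} (off s + V(s, a))`, where `opt` is the maximum in
states of Maximizer and the minimum in states of Minimizer. -/
def Objective.IsFixpointLinear {S A : Type*} [Fintype S]
    [MeasurableSpace S] [DiscreteMeasurableSpace S] [MeasurableSpace A] [DiscreteMeasurableSpace A]
    (Φ : Objective S A) : Prop :=
  ∃ off : S → ℝ, (∀ s, 0 ≤ off s) ∧
    ∀ G : StochasticGame S A, G.WellFormed → G.IsCanonical Φ →
      (∀ s ∈ G.maxStates, IsGreatest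
        {x | ∃ a ∈ G.avail s, x = off s + G.next (G.realValue Φ) s a} (G.realValue Φ s)) ∧
      (∀ s ∈ G.minStates, IsLeast
        {x | ∃ a ∈ G.avail s, x = off s + G.next (G.realValue Φ) s a} (G.realValue Φ s))

end

/-! Part 1 compares `τ` with an optimal Maximizer strategy `σo`. If `σo` only uses actions of `E`
inside `E`, the play under `(σo, τ)` never leaves `E`, so its payoff, which is at least the value,
is also a payoff of the restricted MDP and bounds the staying value from below
(`value_le_stay_fixMin`). Otherwise `σo` exits at some `t` in `E`. The equation for `G` alone does
not say that `σo t` is an optimal action. Fixing `σo`, however, leaves all values unchanged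
(`value_fixMax`), and fixpoint-linearity of the resulting MDP gives `V t = off t + V(t, σo t)`.
Simplicity forces `off t ≤ 0`, hence `V t ≤ V(t, σo t) ≤ f(t, σo t)`, which is at most the exit
value. Since `V` is constant on a simple end component, the bound holds at every state of `E`. Part
2 is dual, with `off t ≥ 0` now having the useful sign. -/

/-! ### Path laws of Markov chains confined to a closed set. -/

section Chain

variable {S A : Type*} [Fintype S] [MeasurableSpace S] [DiscreteMeasurableSpace S]
  [MeasurableSpace A]

/-- A Markov chain started in a closed set almost surely stays there, and modifying the transition
function outside of the closed set does not change its finite-dimensional laws. -/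
theorem chainMeasure_map_frestrictLe_congr {P P' : S → PMF S} {C : Set S}
    (hC : ∀ t ∈ C, (P t).support ⊆ C) (hP : ∀ t ∈ C, P t = P' t) {s : S} (hs : s ∈ C) (n : ℕ) :
    (chainMeasure P s).map (Preorder.frestrictLe n) =
        (chainMeasure P' s).map (Preorder.frestrictLe n) ∧
      ∀ᵐ ρ ∂(chainMeasure P s), ρ n ∈ C := by
  have hproj : ∀ (Q : S → PMF S) (m : ℕ), (chainMeasure Q s).map (Preorder.frestrictLe m) =
      Kernel.partialTraj (X := fun _ => S) (stepKernel Q) 0 m (fun _ => s) := fun Q m =>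
    Kernel.traj_map_frestrictLe_apply (X := fun _ => S) (κ := stepKernel Q) 0 m _
  have hpair : ∀ (Q : S → PMF S) (m : ℕ),
      ((chainMeasure Q s).map (Preorder.frestrictLe m)) ⊗ₘ stepKernel Q m =
        (chainMeasure Q s).map (fun ρ => (Preorder.frestrictLe m ρ, ρ (m + 1))) := by
    intro Q m
    rw [hproj]
    exact Kernel.partialTraj_compProd_eq_map_traj (X := fun _ => S) (κ := stepKernel Q)
      (Nat.zero_le m)
  have hdirac : ∀ Q : S → PMF S, (chainMeasure Q s).map (Preorder.frestrictLe 0) =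
      Measure.dirac (fun _ => s) := by
    intro Q
    rw [hproj, Kernel.partialTraj_self, Kernel.id_apply]
  induction n with
  | zero =>
    refine ⟨by rw [hdirac, hdirac], ?_⟩
    refine ae_of_ae_map (f := Preorder.frestrictLe (π := fun _ => S) 0)
      (p := fun h => h ⟨0, Finset.mem_Iic.2 le_rfl⟩ ∈ C) (by fun_prop) ?_
    rw [hdirac]
    exact (ae_dirac_iff (Set.Finite.measurableSet (Set.toFinite _))).2 hs
  | succ n ih =>
    obtain ⟨hmap, hae⟩ := ih
    have hlast : ∀ᵐ h ∂((chainMeasure P s).map (Preorder.frestrictLe (π := fun _ => S) n)),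
        h ⟨n, Finset.mem_Iic.2 le_rfl⟩ ∈ C :=
      (ae_map_iff (by fun_prop) (Set.Finite.measurableSet (Set.toFinite _))).2 hae
    have hlaw : (chainMeasure P s).map (fun ρ => (Preorder.frestrictLe n ρ, ρ (n + 1))) =
        (chainMeasure P' s).map (fun ρ => (Preorder.frestrictLe n ρ, ρ (n + 1))) := by
      -- The two step kernels agree only on histories ending in `C`. By the induction hypothesis
      -- almost every history does, which is why both claims are proved together.
      rw [← hpair P, ← hpair P', ← hmap]
      refine Measure.compProd_congr ?_
      filter_upwards [hlast] with h hh
      simp [stepKernel, chainKernel, Kernel.comap_apply, hP _ hh]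
    refine ⟨?_, ?_⟩
    -- `g` appends the new state to the history, so the law of the longer history is an image of the
    -- joint law `hlaw`.
    · let g : ((Π _ : Finset.Iic n, S) × S) → (Π _ : Finset.Iic (n + 1), S) := fun p i =>
        if h : i.1 ≤ n then p.1 ⟨i.1, Finset.mem_Iic.2 h⟩ else p.2
      have hg : (Preorder.frestrictLe (π := fun _ => S) (n + 1)) =
          g ∘ fun ρ => (Preorder.frestrictLe n ρ, ρ (n + 1)) := by
        funext ρ i
        by_cases h : i.1 ≤ n
        · simp [g, h]
        · have hi : i.1 = n + 1 := by
            have := Finset.mem_Iic.1 i.2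
            omega
          simp [g, hi]
      have hgm : Measurable g := Measurable.of_discrete
      rw [hg, ← Measure.map_map hgm (by fun_prop), hlaw, Measure.map_map hgm (by fun_prop)]
    · refine ae_of_ae_map (f := fun ρ : ℕ → S => (Preorder.frestrictLe (π := fun _ => S) n ρ,
        ρ (n + 1))) (p := fun q => q.2 ∈ C) (by fun_prop) ?_
      rw [← hpair P, Measure.ae_compProd_iff (Set.Finite.measurableSet (Set.toFinite _))]
      filter_upwards [hlast] with h hh
      rw [ae_iff]
      change (P (h ⟨n, _⟩)).toMeasure {t | t ∉ C} = 0
      rw [PMF.toMeasure_apply_eq_zero_iff _ (Set.Finite.measurableSet (Set.toFinite _))]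
      exact Set.disjoint_left.2 fun t ht hn => hn (hC _ hh ht)

/-- The law of a Markov chain started in a closed set depends only on the transition function on
that set. -/
theorem chainMeasure_congr {P P' : S → PMF S} {C : Set S}
    (hC : ∀ t ∈ C, (P t).support ⊆ C) (hP : ∀ t ∈ C, P t = P' t) {s : S} (hs : s ∈ C) :
    chainMeasure P s = chainMeasure P' s := by
  have hlim := Kernel.isProjectiveLimit_trajFun (X := fun _ => S) (κ := stepKernel P') 0
    (fun _ => s)
  have hprob := Kernel.isProbabilityMeasure_trajFun (X := fun _ => S) (stepKernel P') 0
    (fun _ => s)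
  have hfin : ∀ I, IsFiniteMeasure (inducedFamily (X := fun _ => S)
      (fun n => Kernel.partialTraj (X := fun _ => S) (stepKernel P') 0 n (fun _ => s)) I) :=
    fun I => by rw [← hlim I]; infer_instance
  -- A law on sequences is determined by its initial segments, so it suffices that the `P`-chain has
  -- the initial segments of the `P'`-chain.
  refine IsProjectiveLimit.unique ?_ hlim
  refine (isProjectiveLimit_nat_iff
    (Kernel.isProjectiveMeasureFamily_partialTraj (X := fun _ => S) _ _) _).2 fun n => ?_
  rw [inducedFamily_Iic, (chainMeasure_map_frestrictLe_congr hC hP hs n).1]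
  exact Kernel.traj_map_frestrictLe_apply (X := fun _ => S) (κ := stepKernel P') 0 n _

/-- The law of the infinite path started in a closed set depends only on the transitions and the
actions in that set. -/
theorem pathLaw_congr {P P' : S → PMF S} {π π' : S → A} {C : Set S}
    (hC : ∀ t ∈ C, (P t).support ⊆ C) (hP : ∀ t ∈ C, P t = P' t) (hπ : ∀ t ∈ C, π t = π' t)
    {s : S} (hs : s ∈ C) : pathLaw P π s = pathLaw P' π' s := by
  unfold pathLaw
  rw [← chainMeasure_congr hC hP hs]
  refine Measure.map_congr ?_
  filter_upwards [ae_all_iff.2 fun n => (chainMeasure_map_frestrictLe_congr hC hP hs n).2]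
    with ρ hρ
  funext i
  rw [hπ _ (hρ i)]

end Chain

/-! ### Strategies, and the decision processes obtained by fixing one of them. -/

namespace StochasticGame

variable {S A : Type*}

theorem profile_mem_avail {G : StochasticGame S A} {σ τ : S → A} (hσ : G.IsMaxStrategy σ)
    (hτ : G.IsMinStrategy τ) {s : S} (hs : s ∈ G.states) : G.profile σ τ s ∈ G.avail s := by
  unfold profile
  split_ifs with h
  · exact hσ s h
  · exact hτ s (hs.resolve_left h)

theorem WellFormed.notMem_maxStates {G : StochasticGame S A} (hG : G.WellFormed) {s : S}
    (hs : s ∈ G.minStates) : s ∉ G.maxStates := fun h => Set.disjoint_left.1 hG.disjoint h hs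

theorem WellFormed.notMem_minStates {G : StochasticGame S A} (hG : G.WellFormed) {s : S}
    (hs : s ∈ G.maxStates) : s ∉ G.minStates := fun h => Set.disjoint_left.1 hG.disjoint hs h

@[simp] theorem states_fixMax (G : StochasticGame S A) (σ : S → A) :
    (G.fixMax σ).states = G.states := by simp [fixMax, states]

@[simp] theorem states_fixMin (G : StochasticGame S A) (τ : S → A) :
    (G.fixMin τ).states = G.states := by simp [fixMin, states]

theorem WellFormed.fixMax {G : StochasticGame S A} (hG : G.WellFormed) {σ : S → A}
    (hσ : G.IsMaxStrategy σ) : (G.fixMax σ).WellFormed where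
  disjoint := by simp [StochasticGame.fixMax]
  avail_nonempty s hs := by
    rw [states_fixMax] at hs
    by_cases h : s ∈ G.maxStates <;> simp [StochasticGame.fixMax, h, hG.avail_nonempty s hs]
  post_subset s hs a ha := by
    rw [states_fixMax] at hs ⊢
    refine hG.post_subset s hs a ?_
    by_cases h : s ∈ G.maxStates
    · obtain rfl : a = σ s := by simpa [StochasticGame.fixMax, h] using ha
      exact hσ s h
    · simpa [StochasticGame.fixMax, h] using ha

theorem WellFormed.fixMin {G : StochasticGame S A} (hG : G.WellFormed) {τ : S → A}
    (hτ : G.IsMinStrategy τ) : (G.fixMin τ).WellFormed where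
  disjoint := by simp [StochasticGame.fixMin]
  avail_nonempty s hs := by
    rw [states_fixMin] at hs
    by_cases h : s ∈ G.minStates <;> simp [StochasticGame.fixMin, h, hG.avail_nonempty s hs]
  post_subset s hs a ha := by
    rw [states_fixMin] at hs ⊢
    refine hG.post_subset s hs a ?_
    by_cases h : s ∈ G.minStates
    · obtain rfl : a = τ s := by simpa [StochasticGame.fixMin, h] using ha
      exact hτ s h
    · simpa [StochasticGame.fixMin, h] using ha

/-- In `G.fixMax σ` Minimizer owns every state, so its strategies must copy `σ` on the former
Maximizer states, where `σ s` is the only action left. -/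
theorem isMinStrategy_fixMax_iff {G : StochasticGame S A} (hG : G.WellFormed) {σ τ : S → A} :
    (G.fixMax σ).IsMinStrategy τ ↔ G.IsMinStrategy τ ∧ ∀ s ∈ G.maxStates, τ s = σ s := by
  constructor
  · refine fun h => ⟨fun s hs => ?_, fun s hs => ?_⟩
    · simpa [fixMax, hG.notMem_maxStates hs] using h s (Or.inr hs)
    · simpa [fixMax, hs] using h s (Or.inl hs)
  · rintro ⟨h₁, h₂⟩ s hs
    by_cases h : s ∈ G.maxStates
    · simp [fixMax, h, h₂ s h]
    · simpa [fixMax, h] using h₁ s (hs.resolve_left h)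

theorem isMaxStrategy_fixMin_iff {G : StochasticGame S A} (hG : G.WellFormed) {σ τ : S → A} :
    (G.fixMin τ).IsMaxStrategy σ ↔ G.IsMaxStrategy σ ∧ ∀ s ∈ G.minStates, σ s = τ s := by
  constructor
  · refine fun h => ⟨fun s hs => ?_, fun s hs => ?_⟩
    · simpa [fixMin, hG.notMem_minStates hs] using h s (Or.inl hs)
    · simpa [fixMin, hs] using h s (Or.inr hs)
  · rintro ⟨h₁, h₂⟩ s hs
    by_cases h : s ∈ G.minStates
    · simp [fixMin, h, h₂ s h]
    · simpa [fixMin, h] using h₁ s (hs.resolve_right h)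

theorem profile_of_mem_maxStates {G : StochasticGame S A} {σ τ : S → A} {s : S}
    (hs : s ∈ G.maxStates) : G.profile σ τ s = σ s := if_pos hs

theorem profile_of_mem_minStates {G : StochasticGame S A} (hG : G.WellFormed) {σ τ : S → A}
    {s : S} (hs : s ∈ G.minStates) : G.profile σ τ s = τ s := if_neg (hG.notMem_maxStates hs)

theorem isMinStrategy_fixMax_profile {G : StochasticGame S A} (hG : G.WellFormed) {σ τ : S → A}
    (hτ : G.IsMinStrategy τ) : (G.fixMax σ).IsMinStrategy (G.profile σ τ) :=
  (isMinStrategy_fixMax_iff hG).2 ⟨fun s hs => by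
    rw [profile_of_mem_minStates hG hs]; exact hτ s hs, fun _ hs => profile_of_mem_maxStates hs⟩

theorem isMaxStrategy_fixMin_profile {G : StochasticGame S A} (hG : G.WellFormed) {σ τ : S → A}
    (hσ : G.IsMaxStrategy σ) : (G.fixMin τ).IsMaxStrategy (G.profile σ τ) :=
  (isMaxStrategy_fixMin_iff hG).2 ⟨fun s hs => by
    rw [profile_of_mem_maxStates hs]; exact hσ s hs, fun _ hs => profile_of_mem_minStates hG hs⟩

/-- Every state of an end component has an action in it. -/
theorem IsEndComponent.actions_nonempty_of_mem {G : StochasticGame S A} {E : Component S A}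
    (hE : G.IsEndComponent E) {s : S} (hs : s ∈ E.states) : (E.actions s).Nonempty := by
  obtain ⟨t, ht, hne⟩ := hE.actions_nonempty
  -- The path to `t` is either empty, and then `s` is `t`, or begins with an action of `E` in `s`.
  rcases (hE.connected s hs t ht).cases_head with rfl | ⟨u, ⟨_, a, ha, _⟩, _⟩
  · exact hne
  · exact ⟨a, ha⟩

/-! ### One-step averages and constancy on simple end components. -/

section Next

variable [Fintype S]

theorem next_mono {G : StochasticGame S A} {f g : S → ℝ} {s : S} {a : A}
    (h : ∀ t ∈ G.post s a, f t ≤ g t) : G.next f s a ≤ G.next g s a := by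
  refine Finset.sum_le_sum fun t _ => ?_
  by_cases ht : t ∈ G.post s a
  · exact mul_le_mul_of_nonneg_left (h t ht) ENNReal.toReal_nonneg
  · have h0 : G.trans s a t = 0 := by simpa [post] using ht
    simp [h0]

theorem sum_toReal_trans (G : StochasticGame S A) (s : S) (a : A) :
    ∑ t, (G.trans s a t).toReal = 1 := by
  rw [← ENNReal.toReal_sum fun t _ => (G.trans s a).apply_ne_top t,
    ← tsum_fintype (L := .unconditional S), (G.trans s a).tsum_coe, ENNReal.toReal_one]

/-- If the average of `f` over the successors is attained by the largest value, then all successors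
have this value. -/
theorem eq_of_next_eq {G : StochasticGame S A} {f : S → ℝ} {s t : S} {a : A} {c : ℝ}
    (hle : ∀ u ∈ G.post s a, f u ≤ c) (hc : c ≤ G.next f s a) (ht : t ∈ G.post s a) : f t = c := by
  by_contra hne
  have hlt : f t < c := lt_of_le_of_ne (hle t ht) hne
  have hpos : 0 < (G.trans s a t).toReal :=
    ENNReal.toReal_pos ((PMF.mem_support_iff _ _).1 ht) ((G.trans s a).apply_ne_top t)
  have : G.next f s a < ∑ u, (G.trans s a u).toReal * c := by
    refine Finset.sum_lt_sum (fun u _ => ?_) ⟨t, Finset.mem_univ t, mul_lt_mul_of_pos_left hlt hpos⟩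
    by_cases hu : u ∈ G.post s a
    · exact mul_le_mul_of_nonneg_left (hle u hu) ENNReal.toReal_nonneg
    · have h0 : G.trans s a u = 0 := by simpa [post] using hu
      simp [h0]
  rw [← Finset.sum_mul, sum_toReal_trans, one_mul] at this
  exact absurd hc (not_le.2 this)

/-- The assignment of a simple end component is constant on it. -/
theorem IsSimpleEndComponent.eq {G : StochasticGame S A} {f : S → ℝ} {E : Component S A}
    (hE : G.IsSimpleEndComponent f E) {s t : S} (hs : s ∈ E.states) (ht : t ∈ E.states) :
    f s = f t := by
  -- Maximum principle: where the maximum is attained, it is an average of successor values that do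
  -- not exceed it, so all successors under actions of `E` attain it. It thus spreads along paths
  -- from `m`.
  obtain ⟨m, hm, hmax⟩ := Set.exists_max_image E.states f (Set.toFinite _) hE.nonempty
  have key : ∀ u ∈ E.states, f u = f m := by
    intro u hu
    have hpath := hE.connected m hm u hu
    clear hu
    induction hpath with
    | refl => rfl
    | tail _ hstep ih =>
      obtain ⟨hv, a, ha, hw⟩ := hstep
      refine eq_of_next_eq (fun x hx => hmax x (hE.closed _ hv a ha hx)) ?_ hw
      rw [← hE.eq_next _ hv a ha, ih]
  rw [key s hs, key t ht]

end Next

end StochasticGame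

/-! ### Canonical form under a fixed strategy. -/

namespace StochasticGame

section Canonical

variable {S A : Type*} [MeasurableSpace S] [DiscreteMeasurableSpace S]
  [MeasurableSpace A] [DiscreteMeasurableSpace A]

theorem IsCanonical.coe_realValue {G : StochasticGame S A} {Φ : Objective S A}
    (hcan : G.IsCanonical Φ) {s : S} (hs : s ∈ G.states) :
    (G.realValue Φ s : EReal) = G.value Φ s :=
  EReal.coe_toReal (hcan.value_ne_top s hs) (hcan.value_ne_bot s hs)

/-- An absorbing state has one action, which `σ` has to choose; finiteness of the values is
transferred by `hval`. -/
theorem IsCanonical.fixMax {G : StochasticGame S A} {Φ : Objective S A} (hcan : G.IsCanonical Φ)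
    {σ : S → A} (hσ : G.IsMaxStrategy σ)
    (hval : ∀ s ∈ G.states, (G.fixMax σ).value Φ s = G.value Φ s) :
    (G.fixMax σ).IsCanonical Φ where
  absorbing s hs habs := by
    rw [states_fixMax] at hs
    obtain ⟨a, ha, hpure⟩ := hcan.absorbing s hs habs
    refine ⟨a, ?_, hpure⟩
    by_cases h : s ∈ G.maxStates
    · have h' : σ s = a := by simpa [ha] using hσ s h
      simp [StochasticGame.fixMax, h, h']
    · simp [StochasticGame.fixMax, h, ha]
  value_ne_top s hs := by
    rw [states_fixMax] at hs
    rw [hval s hs]; exact hcan.value_ne_top s hs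
  value_ne_bot s hs := by
    rw [states_fixMax] at hs
    rw [hval s hs]; exact hcan.value_ne_bot s hs

theorem IsCanonical.fixMin {G : StochasticGame S A} {Φ : Objective S A} (hcan : G.IsCanonical Φ)
    {τ : S → A} (hτ : G.IsMinStrategy τ)
    (hval : ∀ s ∈ G.states, (G.fixMin τ).value Φ s = G.value Φ s) :
    (G.fixMin τ).IsCanonical Φ where
  absorbing s hs habs := by
    rw [states_fixMin] at hs
    obtain ⟨a, ha, hpure⟩ := hcan.absorbing s hs habs
    refine ⟨a, ?_, hpure⟩
    by_cases h : s ∈ G.minStates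
    · have h' : τ s = a := by simpa [ha] using hτ s h
      simp [StochasticGame.fixMin, h, h']
    · simp [StochasticGame.fixMin, h, ha]
  value_ne_top s hs := by
    rw [states_fixMin] at hs
    rw [hval s hs]; exact hcan.value_ne_top s hs
  value_ne_bot s hs := by
    rw [states_fixMin] at hs
    rw [hval s hs]; exact hcan.value_ne_bot s hs

end Canonical

/-! ### Payoffs and values under fixed strategies. -/

section Value

variable {S A : Type*} [Fintype S] [MeasurableSpace S] [DiscreteMeasurableSpace S]
  [MeasurableSpace A] [DiscreteMeasurableSpace A]

/-- The expected payoffs of two strategy profiles, possibly in different games, agree in every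
closed set of states on which the chosen actions and their transitions agree. -/
theorem expPayoff_congr {G H : StochasticGame S A} (Φ : Objective S A) {σ τ σ' τ' : S → A}
    {C : Set S} (htrans : G.trans = H.trans)
    (hprof : ∀ t ∈ C, G.profile σ τ t = H.profile σ' τ' t)
    (hC : ∀ t ∈ C, G.post t (G.profile σ τ t) ⊆ C) {s : S} (hs : s ∈ C) :
    G.expPayoff Φ σ τ s = H.expPayoff Φ σ' τ' s := by
  unfold expPayoff
  rw [pathLaw_congr (P' := fun t => H.trans t (H.profile σ' τ' t)) hC
    (fun t ht => by rw [hprof t ht, htrans]) hprof hs]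

/-- No state of `G.fixMax σ` belongs to Maximizer, so `σ'` is a dummy and Minimizer plays the whole
profile. -/
theorem expPayoff_fixMax {G : StochasticGame S A} (hG : G.WellFormed) {Φ : Objective S A}
    {σ τ : S → A} (hτ : G.IsMinStrategy τ) (σ' : S → A) {s : S} (hσ : G.IsMaxStrategy σ)
    (hs : s ∈ G.states) :
    (G.fixMax σ).expPayoff Φ σ' (G.profile σ τ) s = G.expPayoff Φ σ τ s :=
  (expPayoff_congr (G := G) (σ := σ) (τ := τ) (H := G.fixMax σ)
    (C := G.states) Φ rfl
    (fun _ _ => (if_neg (Set.notMem_empty _)).symm)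
    (fun t ht => hG.post_subset t ht _ (profile_mem_avail hσ hτ ht)) hs).symm

theorem expPayoff_fixMin {G : StochasticGame S A} (hG : G.WellFormed) {Φ : Objective S A}
    {σ τ : S → A} (hτ : G.IsMinStrategy τ) (τ' : S → A) {s : S} (hσ : G.IsMaxStrategy σ)
    (hs : s ∈ G.states) :
    (G.fixMin τ).expPayoff Φ (G.profile σ τ) τ' s = G.expPayoff Φ σ τ s :=
  (expPayoff_congr (G := G) (σ := σ) (τ := τ) (H := G.fixMin τ)
    (C := G.states) Φ rfl
    (fun _ ht => (if_pos ht).symm)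
    (fun t ht => hG.post_subset t ht _ (profile_mem_avail hσ hτ ht)) hs).symm

/-- Fixing an optimal strategy of Maximizer does not change the values. -/
theorem value_fixMax {G : StochasticGame S A} (hG : G.WellFormed) {Φ : Objective S A}
    {σ : S → A} (hσ : G.IsMaxStrategy σ)
    (hopt : ∀ s ∈ G.states, ∀ τ, G.IsMinStrategy τ → G.value Φ s ≤ G.expPayoff Φ σ τ s)
    {s : S} (hs : s ∈ G.states) : (G.fixMax σ).value Φ s = G.value Φ s := by
  refine le_antisymm ?_ ?_
  -- This inequality holds for every `σ`; only the converse uses optimality.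
  · refine iSup_le fun σ' => le_iSup_of_le ⟨σ, hσ⟩ (le_iInf fun τ => ?_)
    refine iInf_le_of_le ⟨_, isMinStrategy_fixMax_profile hG (σ := σ) τ.2⟩ ?_
    rw [expPayoff_fixMax hG τ.2 _ hσ hs]
  · refine le_iSup_of_le ⟨σ, fun t ht => absurd ht (Set.notMem_empty t)⟩ (le_iInf fun τ => ?_)
    obtain ⟨hτ, hτσ⟩ := (isMinStrategy_fixMax_iff hG).1 τ.2
    have hprof : G.profile σ τ.1 = τ.1 := by
      funext t
      unfold profile
      split_ifs with h
      · exact (hτσ t h).symm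
      · rfl
    have := expPayoff_fixMax hG (Φ := Φ) hτ σ hσ hs
    rw [hprof] at this
    rw [this]
    exact hopt s hs _ hτ

/-- Fixing an optimal strategy of Minimizer does not change the values. -/
theorem value_fixMin {G : StochasticGame S A} (hG : G.WellFormed) {Φ : Objective S A}
    {τ : S → A} (hτ : G.IsMinStrategy τ)
    (hopt : ∀ s ∈ G.states, ∀ σ, G.IsMaxStrategy σ → G.expPayoff Φ σ τ s ≤ G.value Φ s)
    {s : S} (hs : s ∈ G.states) : (G.fixMin τ).value Φ s = G.value Φ s := by
  refine le_antisymm ?_ ?_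
  · refine iSup_le fun σ => iInf_le_of_le ⟨τ, fun t ht => absurd ht (Set.notMem_empty t)⟩ ?_
    obtain ⟨hσ, hστ⟩ := (isMaxStrategy_fixMin_iff hG).1 σ.2
    have := expPayoff_congr (G := G) (H := G.fixMin τ) (C := G.states) (σ := σ.1) (τ := τ)
      (σ' := σ.1) (τ' := τ) Φ rfl
      (fun t ht => by
        rw [profile_of_mem_maxStates (G := G.fixMin τ) ht]
        rcases ht with h | h
        · rw [profile_of_mem_maxStates h]
        · rw [profile_of_mem_minStates hG h, hστ t h])
      (fun t ht => hG.post_subset t ht _ (profile_mem_avail hσ hτ ht)) hs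
    rw [← this]
    exact hopt s hs _ hσ
  · refine iSup_le fun σ => ?_
    refine le_iSup_of_le ⟨_, isMaxStrategy_fixMin_profile hG (τ := τ) σ.2⟩ (le_iInf fun τ' => ?_)
    rw [expPayoff_fixMin hG hτ _ σ.2 hs]
    exact iInf_le_of_le ⟨τ, hτ⟩ le_rfl

/-- If an optimal strategy of Maximizer and a strategy of Minimizer both stay in `E`, then the
value is at most the staying value against the latter strategy. -/
theorem value_le_stay_fixMin {G : StochasticGame S A} (hG : G.WellFormed) {Φ : Objective S A}
    {E : Component S A} (hE : G.IsEndComponent E) {σ τ : S → A} (hτ : G.IsMinStrategy τ)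
    (hσ : G.IsMaxStrategy σ)
    (hopt : ∀ s ∈ G.states, ∀ τ, G.IsMinStrategy τ → G.value Φ s ≤ G.expPayoff Φ σ τ s)
    (hσE : ∀ s ∈ E.states ∩ G.maxStates, σ s ∈ E.actions s)
    (hτE : ∀ s ∈ E.states ∩ G.minStates, τ s ∈ E.actions s) {s : S} (hs : s ∈ E.states) :
    G.value Φ s ≤ (G.fixMin τ).stay Φ E s := by
  have hmem : ∀ t ∈ E.states, G.profile σ τ t ∈ E.actions t := by
    intro t ht
    rcases hE.states_subset ht with h | h
    · rw [profile_of_mem_maxStates h]; exact hσE t ⟨ht, h⟩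
    · rw [profile_of_mem_minStates hG h]; exact hτE t ⟨ht, h⟩
  -- Maximizer owns all states of the restricted MDP and can play the whole profile; `τ'` has no
  -- influence.
  refine le_iSup_of_le ⟨G.profile σ τ, fun t ht => ?_⟩ (le_iInf fun τ' => ?_)
  · exact ⟨isMaxStrategy_fixMin_profile hG hσ t ht.1, hmem t ht.2⟩
  · have := expPayoff_congr (G := G) (H := (G.fixMin τ).restrict E) (C := E.states) (σ := σ)
      (τ := τ) (σ' := G.profile σ τ) (τ' := τ'.1) Φ rfl
      (fun t ht => (profile_of_mem_maxStates (G := (G.fixMin τ).restrict E)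
        ⟨hE.states_subset ht, ht⟩).symm)
      (fun t ht => hE.closed t ht _ (hmem t ht)) hs
    rw [← this]
    exact hopt s (hE.states_subset hs) τ hτ

/-- If an optimal strategy of Minimizer and a strategy of Maximizer both stay in `E`, then the
value is at least the staying value against the latter strategy. -/
theorem stay_fixMax_le_value {G : StochasticGame S A} (hG : G.WellFormed) {Φ : Objective S A}
    {E : Component S A} (hE : G.IsEndComponent E) {σ τ : S → A} (hτ : G.IsMinStrategy τ)
    (hσ : G.IsMaxStrategy σ)
    (hopt : ∀ s ∈ G.states, ∀ σ, G.IsMaxStrategy σ → G.expPayoff Φ σ τ s ≤ G.value Φ s)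
    (hσE : ∀ s ∈ E.states ∩ G.maxStates, σ s ∈ E.actions s)
    (hτE : ∀ s ∈ E.states ∩ G.minStates, τ s ∈ E.actions s) {s : S} (hs : s ∈ E.states) :
    (G.fixMax σ).stay Φ E s ≤ G.value Φ s := by
  have hmem : ∀ t ∈ E.states, G.profile σ τ t ∈ E.actions t := by
    intro t ht
    rcases hE.states_subset ht with h | h
    · rw [profile_of_mem_maxStates h]; exact hσE t ⟨ht, h⟩
    · rw [profile_of_mem_minStates hG h]; exact hτE t ⟨ht, h⟩
  refine iSup_le fun σ' => iInf_le_of_le ⟨G.profile σ τ, fun t ht => ?_⟩ ?_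
  · exact ⟨isMinStrategy_fixMax_profile hG hτ t ht.1, hmem t ht.2⟩
  · have := expPayoff_congr (G := G) (H := (G.fixMax σ).restrict E) (C := E.states) (σ := σ)
      (τ := τ) (σ' := σ'.1) (τ' := G.profile σ τ) Φ rfl
      (fun t _ => (if_neg fun h => Set.notMem_empty t h.1).symm)
      (fun t ht => hE.closed t ht _ (hmem t ht)) hs
    rw [← this]
    exact hopt s (hE.states_subset hs) σ hσ

end Value

end StochasticGame

/-! ### The two bounds. -/

theorem mainTheorem6 {S A : Type*} [Fintype S] [Fintype A]
    [MeasurableSpace S] [DiscreteMeasurableSpace S] [MeasurableSpace A] [DiscreteMeasurableSpace A]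
    (G : StochasticGame S A) (hG : G.WellFormed)
    (Φ : Objective S A) (hΦ : Φ.IsFixpointLinear)
    (hcan : G.IsCanonical Φ) (hopt : G.HasOptimalStrategies Φ)
    (E : Component S A) (hE : G.IsSimpleEndComponent (G.realValue Φ) E)
    (hstay : G.ContainsStayingActions E) :
    (∀ τ : S → A, G.IsMinStrategy τ →
      (∀ s ∈ E.states ∩ G.minStates, τ s ∈ E.actions s) →
      ∀ f : S → ℝ, (∀ s ∈ G.states, G.value Φ s ≤ (f s : EReal)) →
      ∀ s ∈ E.states,
        G.value Φ s ≤ max ((G.fixMin τ).stay Φ E s) (G.exitMax f E)) ∧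
    (∀ σ : S → A, G.IsMaxStrategy σ →
      (∀ s ∈ E.states ∩ G.maxStates, σ s ∈ E.actions s) →
      ∀ f : S → ℝ, (∀ s ∈ G.states, (f s : EReal) ≤ G.value Φ s) →
      ∀ s ∈ E.states,
        min ((G.fixMax σ).stay Φ E s) (G.exitMin f E) ≤ G.value Φ s) := by
  obtain ⟨off, hoff, hfix⟩ := hΦ
  obtain ⟨⟨σo, hσo, hσopt⟩, τo, hτo, hτopt⟩ := hopt
  have hsub := hE.states_subset
  refine ⟨fun τ hτ hτE f hf s hs => ?_, fun σ hσ hσE f hf s hs => ?_⟩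
  · by_cases hin : ∀ t ∈ E.states ∩ G.maxStates, σo t ∈ E.actions t
    · exact le_max_of_le_left
        (G.value_le_stay_fixMin hG hE.toIsEndComponent hτ hσo hσopt hin hτE hs)
    push Not at hin
    obtain ⟨t, ⟨htE, htmax⟩, hnot⟩ := hin
    have hexit : G.Exits E t (σo t) := by
      by_contra h
      exact hnot (hstay t htE _ (hσo t htmax) h)
    have hpost := hG.post_subset t (hsub htE) _ (hσo t htmax)
    refine le_max_of_le_right (le_trans ?_ (le_sSup ⟨t, htmax, σo t, hexit, rfl⟩))
    -- An action `b` of `E` gives `V t ≥ off t + V(t, b)`, and `V(t, b) = V t` by simplicity.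
    have hoff0 : off t ≤ 0 := by
      obtain ⟨b, hb⟩ := hE.toIsEndComponent.actions_nonempty_of_mem htE
      have := ((hfix G hG hcan).1 t htmax).2 ⟨b, hE.actions_subset t htE hb, rfl⟩
      rw [← hE.eq_next t htE b hb] at this
      linarith
    have hval := fun u hu => StochasticGame.value_fixMax hG hσo hσopt (s := u) hu
    -- In the MDP `t` is a Minimizer state with the single action `σo t`, so the minimum is an
    -- equation for this action.
    obtain ⟨a, ha, hVt⟩ := ((hfix _ (hG.fixMax hσo) (hcan.fixMax hσo hval)).2 t (hsub htE)).1
    obtain rfl : a = σo t := by simpa [StochasticGame.fixMax, htmax] using ha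
    have hreal : ∀ u ∈ G.states, (G.fixMax σo).realValue Φ u = G.realValue Φ u := fun u hu => by
      simp only [StochasticGame.realValue, hval u hu]
    rw [hreal t (hsub htE)] at hVt
    have hle : (G.fixMax σo).next ((G.fixMax σo).realValue Φ) t (σo t) ≤ G.next f t (σo t) := by
      refine StochasticGame.next_mono (G := G) fun u hu => ?_
      rw [hreal u (hpost hu), ← EReal.coe_le_coe_iff, hcan.coe_realValue (hpost hu)]
      exact hf u (hpost hu)
    rw [← hcan.coe_realValue (hsub hs), hE.eq hs htE, EReal.coe_le_coe_iff]
    linarith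
  · by_cases hin : ∀ t ∈ E.states ∩ G.minStates, τo t ∈ E.actions t
    · exact min_le_of_left_le
        (G.stay_fixMax_le_value hG hE.toIsEndComponent hτo hσ hτopt hσE hin hs)
    push Not at hin
    obtain ⟨t, ⟨htE, htmin⟩, hnot⟩ := hin
    have hexit : G.Exits E t (τo t) := by
      by_contra h
      exact hnot (hstay t htE _ (hτo t htmin) h)
    have hpost := hG.post_subset t (hsub htE) _ (hτo t htmin)
    refine min_le_of_right_le (le_trans (sInf_le ⟨t, htmin, τo t, hexit, rfl⟩) ?_)
    have hval := fun u hu => StochasticGame.value_fixMin hG hτo hτopt (s := u) hu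
    obtain ⟨a, ha, hVt⟩ := ((hfix _ (hG.fixMin hτo) (hcan.fixMin hτo hval)).1 t (hsub htE)).1
    obtain rfl : a = τo t := by simpa [StochasticGame.fixMin, htmin] using ha
    have hreal : ∀ u ∈ G.states, (G.fixMin τo).realValue Φ u = G.realValue Φ u := fun u hu => by
      simp only [StochasticGame.realValue, hval u hu]
    rw [hreal t (hsub htE)] at hVt
    have hle : G.next f t (τo t) ≤ (G.fixMin τo).next ((G.fixMin τo).realValue Φ) t (τo t) := by
      refine StochasticGame.next_mono (G := G) fun u hu => ?_
      rw [hreal u (hpost hu), ← EReal.coe_le_coe_iff, hcan.coe_realValue (hpost hu)]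
      exact hf u (hpost hu)
    rw [← hcan.coe_realValue (hsub hs), hE.eq hs htE, EReal.coe_le_coe_iff]
    -- Nonnegativity of the offset suffices here; simplicity enters only through the constancy of
    -- `V` on `E`.
    linarith [hoff t]
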